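/- Let $G$ be a finite group generated by elements $t_1,\dots,t_d$ (repetitions allowed, $d \ge 0$ an integer), let $F$ be the free group on $x_1,\dots,x_d$, and let $\pi\colon F\to G$ be the homomorphism with $\pi(x_i)=t_i$. Let $p$ be a prime with $p\nmid |G|$, let $r,s\ge 0$, let $w_1,\dots,w_r\in F$, and let $H_1,\dots,H_s$ be subgroups of $G$; if $d=1$, assume $r=0$, so that the following expression makes sense. Assume that $$\delta := 1-\sum_{i=1}^r \frac{1}{\operatorname{ord}(\pi(w_i))\,(d-1)}-\sum_{j=1}^s\frac{|G|}{|H_j|\cdot|N_G(H_j)|}>0 ,$$ where $N_G(H_j)$ is the normalizer of $H_j$ in $G$. Then there are a finite-dimensional $\mathbb{F}_p[G]$-module $V$ with $$\dim_{\mathbb{F}_p}V\ \ge\ (d-1)\,|G|\,\delta$$ and elements $v_1,\dots,v_d\in V$ such that the elements $\tilde t_i:=(v_i,t_i)$, $i \in \{1,\dots,d\}$, generate the semidirect product $V\rtimes G$ and the following hold: (a) $\operatorname{ord}(\tilde\pi(w_i))=\operatorname{ord}(\pi(w_i))$ for all $i\in\{1,\dots,r\}$, where $\tilde\pi\colon F\to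 V\rtimes G$ is the homomorphism with $\tilde\pi(x_i)=\tilde t_i$; (b) $V^{H_j}=\{0\}$ for all $j\in\{1,\dots,s\}$; (c) $\dim_{\mathbb{F}_p}V^K\le \dfrac{1}{\delta|K|}\dim_{\mathbb{F}_p}V$ for every subgroup $K\le G$. Here $V^K$ denotes the subspace of vectors of $V$ fixed by $K$. -/

import Mathlib

/-- The action of `G` on the (multiplicatively written) additive group of a representation `ρ`
on `V`, by group automorphisms: `g` acts by `v ↦ ρ g v`. -/
def repMulAut {k G V : Type*} [CommRing k] [Group G] [AddCommGroup V] [Module k V]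
    (ρ : Representation k G V) : G →* MulAut (Multiplicative V) where
  toFun g :=
    { toFun := fun v => Multiplicative.ofAdd (ρ g v.toAdd)
      invFun := fun v => Multiplicative.ofAdd (ρ g⁻¹ v.toAdd)
      left_inv := fun v => by simp
      right_inv := fun v => by simp
      map_mul' := fun v w => by simp }
  map_one' := by ext v; simp
  map_mul' g h := by ext v; simp

/-- The semidirect product `V ⋊ G` of a group `G` with a representation `ρ` of `G` on `V`;
its multiplication is `(v, g) (w, h) = (v + g w, g h)`. -/
abbrev RepSemidirect {k G V : Type*} [CommRing k] [Group G] [AddCommGroup V] [Module k V]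
    (ρ : Representation k G V) : Type _ :=
  Multiplicative V ⋊[repMulAut ρ] G

/-- The element `(v, g)` of `V ⋊ G`. -/
def repPair {k G V : Type*} [CommRing k] [Group G] [AddCommGroup V] [Module k V]
    (ρ : Representation k G V) (v : V) (g : G) : RepSemidirect ρ :=
  ⟨Multiplicative.ofAdd v, g⟩

/-- The subspace `V ^ H` of vectors of `V` fixed by the subgroup `H` of `G`. -/
noncomputable abbrev fixedVectors {k G V : Type*} [CommRing k] [Group G] [AddCommGroup V] [Module k V]
    (ρ : Representation k G V) (H : Subgroup G) : Submodule k V :=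
  Representation.invariants (ρ.comp H.subtype)

/-! Let d > 0 and let R be the group algebra of G over F_p. As p ∤ |G|, adding an averaging term to
e_i ↦ t_i - 1 gives a surjection θ : R^d → R. With θ a₀ = 1, R^d = ker θ ⊕ R a₀, and ker θ has
dimension (d-1)|G|. Take V = R^d / N and v_i the image of e_i, where N is generated by a₀ and the
obstructions to (a) and (b).

Generation holds in any such quotient. Since H¹ vanishes, failure would give a proper submodule
containing a₀ modulo which e_i ≡ (t_i - 1)u for some u; then any a in ker θ is ≡ ∑ a_i (t_i - 1)u =
0, so the submodule is everything (`closure_repPair_eq_top`, `eq_top_of_coboundary`).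

For (a), the ord(π(w_i))-th power of the lifted word is a vector fixed by π(w_i); killing it costs
at most |G|/ord(π(w_i)) dimensions. For (b), kill (ker θ)^{H_j}: it has dimension at most
(d-1)|G|/|H_j| and is normalizer-stable, so it generates a sum of at most |G : N_G(H_j)| translates.
What remains is at least (d-1)|G|δ. For (c), invariants lift, so V^K is an image of (ker θ)^K, of
dimension at most (d-1)|G|/|K|. -/

open Module in
theorem Submodule.finrank_iSup_le_sum {k V ι : Type*} [Field k] [AddCommGroup V] [Module k V]
    [Module.Finite k V] [Fintype ι] (D : ι → Submodule k V) :
    finrank k ↥(⨆ i, D i) ≤ ∑ i, finrank k (D i) := by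
  classical
  rw [← Finset.sup_univ_eq_iSup]
  induction (Finset.univ : Finset ι) using Finset.induction_on with
  | empty => simp
  | insert a s ha ih =>
    rw [Finset.sup_insert, Finset.sum_insert ha]
    exact (Submodule.finrank_add_le_finrank_add_finrank _ _).trans (by gcongr)

/-! ### Generation of the semidirect product via vanishing of H¹ -/

section Generation

variable {p : ℕ} [Fact p.Prime] {G V ι : Type*} [Group G] [Finite G] [AddCommGroup V]
  [Module (ZMod p) V]

/-- If no proper invariant subspace `N` turns the vectors `v i` into the values of a coboundary
modulo `N`, then the pairs `(v i, t i)` generate the semidirect product. -/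
theorem closure_repPair_eq_top (hp : ¬ p ∣ Nat.card G) (ρ : Representation (ZMod p) G V)
    {t : ι → G} (ht : Subgroup.closure (Set.range t) = ⊤) (v : ι → V)
    (h : ∀ N : Submodule (ZMod p) V, (∀ g, ∀ x ∈ N, ρ g x ∈ N) →
      ∀ u, (∀ i, v i - (ρ (t i) u - u) ∈ N) → N = ⊤) :
    Subgroup.closure (Set.range fun i => repPair ρ (v i) (t i)) = ⊤ := by
  have := Fintype.ofFinite G
  set Γ := Subgroup.closure (Set.range fun i => repPair ρ (v i) (t i)) with hΓ
  have mul_eq (a b : V) (g h : G) :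
      repPair ρ a g * repPair ρ b h = repPair ρ (a + ρ g b) (g * h) := rfl
  have inv_eq (a : V) (g : G) : (repPair ρ a g)⁻¹ = repPair ρ (- ρ g⁻¹ a) g⁻¹ := by
    rw [inv_eq_iff_mul_eq_one, mul_eq]
    simp only [map_neg, mul_inv_cancel]
    rw [← Module.End.mul_apply, ← map_mul]
    simp [repPair]
  have hmem (i : ι) : repPair ρ (v i) (t i) ∈ Γ := Subgroup.subset_closure ⟨i, rfl⟩
  have hsurj (g : G) : ∃ c : V, repPair ρ c g ∈ Γ := by
    have hg : g ∈ Subgroup.closure (Set.range t) := ht ▸ Subgroup.mem_top g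
    induction hg using Subgroup.closure_induction with
    | mem x hx => obtain ⟨i, rfl⟩ := hx; exact ⟨_, hmem i⟩
    | one => exact ⟨0, Γ.one_mem⟩
    | mul x y _ _ hx hy =>
      obtain ⟨a, ha⟩ := hx
      obtain ⟨b, hb⟩ := hy
      exact ⟨_, mul_eq a b x y ▸ Γ.mul_mem ha hb⟩
    | inv x _ hx =>
      obtain ⟨a, ha⟩ := hx
      exact ⟨_, inv_eq a x ▸ Γ.inv_mem ha⟩
  -- `c` is a set-theoretic section of Γ → G; it is a cocycle modulo N = Γ ∩ V.
  choose c hc using hsurj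
  let N₀ : AddSubgroup V :=
    { carrier := {a | repPair ρ a 1 ∈ Γ}
      zero_mem' := Γ.one_mem
      add_mem' := fun {a b} ha hb => by
        have := Γ.mul_mem ha hb
        rw [mul_eq] at this
        simpa using this
      neg_mem' := fun {a} ha => by
        have := Γ.inv_mem ha
        rw [inv_eq] at this
        simpa using this }
  let N : Submodule (ZMod p) V := AddSubgroup.toZModSubmodule p N₀
  have hN (a : V) : a ∈ N ↔ repPair ρ a 1 ∈ Γ := Iff.rfl
  have hdiff {a b : V} {g : G} (ha : repPair ρ a g ∈ Γ) (hb : repPair ρ b g ∈ Γ) :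
      a - b ∈ N := by
    have := Γ.mul_mem ha (Γ.inv_mem hb)
    rw [inv_eq, mul_eq, map_neg, ← Module.End.mul_apply, ← map_mul, mul_inv_cancel, map_one,
      Module.End.one_apply, ← sub_eq_add_neg] at this
    exact this
  have hinv : ∀ g, ∀ x ∈ N, ρ g x ∈ N := by
    intro g x hx
    have := Γ.mul_mem (hc g) hx
    rw [mul_eq, mul_one] at this
    simpa using hdiff this (hc g)
  have hcard : (Fintype.card G : ZMod p) ≠ 0 := by
    rwa [Ne, ZMod.natCast_eq_zero_iff, ← Nat.card_eq_fintype_card]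
  have htop : N = ⊤ := by
    -- Summing the cocycle identity c(t) + t c(g) ≡ c(tg) over g and dividing by |G| exhibits `c` as
    -- the coboundary of minus its average.
    refine h N hinv (-((Fintype.card G : ZMod p)⁻¹ • ∑ g, c g)) fun i => ?_
    have hsum : ∑ g, (c (t i) + ρ (t i) (c g) - c (t i * g)) ∈ N :=
      Submodule.sum_mem _ fun g _ => hdiff (mul_eq _ _ _ _ ▸ Γ.mul_mem (hc (t i)) (hc g)) (hc _)
    have hre : ∑ g, c (t i * g) = ∑ g, c g := Equiv.sum_comp (Equiv.mulLeft (t i)) c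
    rw [Finset.sum_sub_distrib, Finset.sum_add_distrib, hre, Finset.sum_const, Finset.card_univ,
      ← Nat.cast_smul_eq_nsmul (ZMod p), ← map_sum] at hsum
    have key := N.add_mem (hdiff (hmem i) (hc (t i)))
      (N.smul_mem (Fintype.card G : ZMod p)⁻¹ hsum)
    rw [smul_sub, smul_add, smul_smul, inv_mul_cancel₀ hcard, one_smul] at key
    convert key using 1
    rw [map_neg, map_smul]
    abel
  rw [eq_top_iff]
  rintro ⟨a, g⟩ -
  have ha : repPair ρ (a.toAdd - c g) 1 ∈ Γ := (hN _).1 (htop ▸ Submodule.mem_top)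
  have := Γ.mul_mem ha (hc g)
  rw [mul_eq] at this
  simpa [repPair] using this

end Generation

/-! ### Orders of lifted words -/

section Order

variable {k G V ι : Type*} [CommRing k] [Group G] [AddCommGroup V] [Module k V]

theorem right_lift_repPair (ρ : Representation k G V) (v : ι → V) (t : ι → G) (w : FreeGroup ι) :
    (FreeGroup.lift (fun i => repPair ρ (v i) (t i)) w).right = FreeGroup.lift t w := by
  have : SemidirectProduct.rightHom.comp (FreeGroup.lift (fun i => repPair ρ (v i) (t i)))
      = FreeGroup.lift t := by
    ext i
    simp [repPair]
  exact DFunLike.congr_fun this w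

/-- The power of a lifted word which lies in `V` is a vector fixed by the word; killing it makes
the order of the lifted word equal to the order of the word. -/
theorem exists_fixed_relator (ρ : Representation k G V) (v : ι → V) (t : ι → G)
    (w : FreeGroup ι) :
    ∃ a : V, ρ (FreeGroup.lift t w) a = a ∧
      ∀ {W : Type} [AddCommGroup W] [Module k W] (σ : Representation k G W) (f : V →ₗ[k] W),
        (∀ g x, f (ρ g x) = σ g (f x)) → f a = 0 →
        orderOf (FreeGroup.lift (fun i => repPair σ (f (v i)) (t i)) w)
          = orderOf (FreeGroup.lift t w) := by
  set X := FreeGroup.lift (fun i => repPair ρ (v i) (t i)) w with hX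
  set m := orderOf (FreeGroup.lift t w) with hm
  have hXr : X.right = FreeGroup.lift t w := right_lift_repPair ρ v t w
  have hright (n : ℕ) : (X ^ n).right = FreeGroup.lift t w ^ n := by
    rw [← hXr]
    exact map_pow SemidirectProduct.rightHom X n
  have hpow : (X ^ m).right = 1 := by rw [hright, pow_orderOf_eq_one]
  -- X ^ m lies in V and commutes with X, so conjugation by X, which acts on V as the word does,
  -- fixes it.
  refine ⟨(X ^ m).left.toAdd, ?_, ?_⟩
  · have hcomm : X * X ^ m = X ^ m * X := (Commute.self_pow X m).eq
    have := congrArg (fun y => (SemidirectProduct.left y).toAdd) hcomm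
    simp only [SemidirectProduct.mul_left, hpow, map_one, hXr, toAdd_mul, MulAut.one_apply] at this
    rw [add_comm] at this
    exact add_right_cancel this
  · intro W _ _ σ f hf ha
    let F : RepSemidirect ρ →* RepSemidirect σ :=
      SemidirectProduct.map f.toAddMonoidHom.toMultiplicative (MonoidHom.id G)
        fun g => MonoidHom.ext fun x => congrArg Multiplicative.ofAdd (hf g x.toAdd)
    have hF : F X = FreeGroup.lift (fun i => repPair σ (f (v i)) (t i)) w := by
      have : F.comp (FreeGroup.lift (fun i => repPair ρ (v i) (t i)))
          = FreeGroup.lift (fun i => repPair σ (f (v i)) (t i)) := by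
        ext i
        · simp [F, repPair]
        · simp [F, repPair]
      exact DFunLike.congr_fun this w
    apply Nat.dvd_antisymm
    · rw [orderOf_dvd_iff_pow_eq_one, ← hF, ← map_pow]
      ext
      · exact ha
      · exact hpow
    · have := orderOf_map_dvd (SemidirectProduct.rightHom (φ := repMulAut σ))
        (FreeGroup.lift (fun i => repPair σ (f (v i)) (t i)) w)
      rwa [SemidirectProduct.rightHom_eq_right, right_lift_repPair] at this

end Order

/-! ### Lifting invariants -/

section Fixed

variable {k G V W : Type*} [Field k] [Group G] [Finite G] [AddCommGroup V] [Module k V]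
  [AddCommGroup W] [Module k W]

omit [Finite G] in
theorem mem_fixedVectors {ρ : Representation k G V} {K : Subgroup G} {x : V} :
    x ∈ fixedVectors ρ K ↔ ∀ g ∈ K, ρ g x = x := by
  simp [fixedVectors]

/-- Fixed vectors lift along a surjection when the group order is invertible. -/
theorem fixedVectors_le_map {ρ : Representation k G V} {σ : Representation k G W}
    (hG : (Nat.card G : k) ≠ 0) (f : V →ₗ[k] W) (hf : ∀ g x, f (ρ g x) = σ g (f x))
    (hs : Function.Surjective f) (K : Subgroup G) :
    fixedVectors σ K ≤ (fixedVectors ρ K).map f := by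
  have := Fintype.ofFinite K
  intro y hy
  obtain ⟨x, rfl⟩ := hs y
  have hK : (Fintype.card K : k) ≠ 0 := by
    rw [← Nat.card_eq_fintype_card]
    intro h0
    obtain ⟨c, hc⟩ := K.card_subgroup_dvd_card
    exact hG (by rw [hc, Nat.cast_mul, h0, zero_mul])
  -- Any preimage, averaged over K, still maps to the K-fixed vector y.
  refine ⟨(Fintype.card K : k)⁻¹ • ∑ g : K, ρ g x, ?_, ?_⟩
  · rw [SetLike.mem_coe, mem_fixedVectors]
    intro g hg
    rw [map_smul, map_sum]
    congr 1
    simp_rw [← Module.End.mul_apply, ← map_mul]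
    exact Equiv.sum_comp (Equiv.mulLeft (⟨g, hg⟩ : K)) fun h : K => ρ (h : G) x
  · rw [map_smul, map_sum]
    have (g : K) : f (ρ g x) = f x := by rw [hf, mem_fixedVectors.1 hy g g.2]
    simp_rw [this]
    rw [Finset.sum_const, Finset.card_univ, ← Nat.cast_smul_eq_nsmul k, smul_smul,
      inv_mul_cancel₀ hK, one_smul]

end Fixed

/-! ### Dimension bounds for modules over the group algebra -/

open Module MonoidAlgebra

section GroupAlgebraModules

variable {k G M : Type*} [Field k] [Group G] [AddCommGroup M] [Module k M]
  [Module (MonoidAlgebra k G) M] [IsScalarTower k (MonoidAlgebra k G) M]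

theorem ofModule'_apply_eq (g : G) (x : M) :
    (Representation.ofModule' M : Representation k G M) g x = of k G g • x := by
  simp [Representation.ofModule']

/-- A subspace stable under the group is stable under the group algebra. -/
theorem smul_mem_of_forall_of_smul_mem {D : Submodule k M} (h : ∀ g : G, ∀ x ∈ D, of k G g • x ∈ D)
    (r : MonoidAlgebra k G) {x : M} (hx : x ∈ D) : r • x ∈ D := by
  induction r using MonoidAlgebra.induction_on with
  | of g => exact h g x hx
  | add a b ha hb => rw [add_smul]; exact D.add_mem ha hb
  | smul c a ha => rw [smul_assoc]; exact D.smul_mem c ha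

/-- The submodule generated by a subspace `D` which is stable under a subgroup `L` is the sum of
at most `|G : L|` translates of `D`. -/
theorem finrank_span_mul_card_le [Finite G] [Module.Finite k M] (D : Submodule k M)
    (L : Subgroup G) (hL : ∀ g ∈ L, ∀ x ∈ D, of k G g • x ∈ D) :
    finrank k ((Submodule.span (MonoidAlgebra k G) (D : Set M)).restrictScalars k) * Nat.card L
      ≤ Nat.card G * finrank k D := by
  have := Fintype.ofFinite (G ⧸ L)
  let ρ : Representation k G M := Representation.ofModule' M
  let E : G ⧸ L → Submodule k M := fun q => D.map (ρ q.out)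
  have hE : ∀ g : G, ∀ x ∈ D, of k G g • x ∈ E (QuotientGroup.mk g) := by
    intro g x hx
    obtain ⟨l, hl⟩ := QuotientGroup.mk_out_eq_mul L g
    refine ⟨of k G (l : G)⁻¹ • x, hL _ (L.inv_mem l.2) x hx, ?_⟩
    rw [hl, ofModule'_apply_eq, smul_smul, ← map_mul, mul_inv_cancel_right]
  have hle : (Submodule.span (MonoidAlgebra k G) (D : Set M)).restrictScalars k ≤ ⨆ q, E q := by
    have hstable : ∀ g : G, ∀ x ∈ ⨆ q, E q, of k G g • x ∈ ⨆ q, E q := by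
      intro g x hx
      have : ⨆ q, E q ≤ (⨆ q, E q).comap (ρ g) := by
        refine iSup_le fun q => ?_
        rintro _ ⟨y, hy, rfl⟩
        rw [Submodule.mem_comap, ofModule'_apply_eq, ofModule'_apply_eq, smul_smul, ← map_mul]
        exact Submodule.mem_iSup_of_mem _ (hE _ y hy)
      have := this hx
      rwa [Submodule.mem_comap, ofModule'_apply_eq] at this
    intro x hx
    rw [Submodule.restrictScalars_mem] at hx
    induction hx using Submodule.span_induction with
    | mem x hx =>
      have := Submodule.mem_iSup_of_mem (p := E) _ (hE 1 x hx)
      rwa [map_one, one_smul] at this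
    | zero => exact Submodule.zero_mem _
    | add x y _ _ hx hy => exact Submodule.add_mem _ hx hy
    | smul r x _ hx => exact smul_mem_of_forall_of_smul_mem hstable r hx
  calc _ ≤ (∑ q : G ⧸ L, finrank k (E q)) * Nat.card L :=
        Nat.mul_le_mul_right _ ((Submodule.finrank_mono hle).trans
          (Submodule.finrank_iSup_le_sum E))
    _ ≤ (∑ q : G ⧸ L, finrank k D) * Nat.card L := by
        gcongr
        exact Submodule.finrank_map_le _ _
    _ = Nat.card G * finrank k D := by
        rw [Finset.sum_const, Finset.card_univ, smul_eq_mul, L.card_eq_card_quotient_mul_card_subgroup,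
          ← Nat.card_eq_fintype_card]
        ring

/-- The cyclic module generated by a vector fixed by `g` has dimension at most
`|G| / orderOf g`. -/
theorem finrank_span_singleton_mul_orderOf_le [Finite G] [Module.Finite k M] (x : M) (g : G)
    (hx : of k G g • x = x) :
    finrank k ((Submodule.span (MonoidAlgebra k G) {x}).restrictScalars k) * orderOf g
      ≤ Nat.card G := by
  have hstab : ∀ h ∈ Subgroup.zpowers g, of k G h • x = x := by
    intro h hh
    rw [Subgroup.zpowers_eq_closure] at hh
    induction hh using Subgroup.closure_induction with
    | mem y hy => rw [Set.mem_singleton_iff.1 hy, hx]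
    | one => rw [map_one, one_smul]
    | mul y z _ _ hy hz => rw [map_mul, mul_smul, hz, hy]
    | inv y _ hy => nth_rw 1 [← hy]; rw [smul_smul, ← map_mul, inv_mul_cancel, map_one, one_smul]
  rw [← Nat.card_zpowers, ← Submodule.span_span_of_tower k]
  refine (finrank_span_mul_card_le _ (Subgroup.zpowers g) fun h hh y hy => ?_).trans ?_
  · obtain ⟨c, rfl⟩ := Submodule.mem_span_singleton.1 hy
    rw [smul_comm, hstab h hh]
    exact hy
  · exact (Nat.mul_le_mul_left _ ((finrank_span_le_card _).trans (by simp))).trans_eq (mul_one _)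

theorem finrank_restrictScalars_sup_le [Module.Finite k M]
    (X Y : Submodule (MonoidAlgebra k G) M) :
    finrank k ((X ⊔ Y).restrictScalars k) ≤
      finrank k (X.restrictScalars k) + finrank k (Y.restrictScalars k) := by
  rw [Submodule.restrictScalars_sup]
  exact Submodule.finrank_add_le_finrank_add_finrank _ _

theorem finrank_restrictScalars_iSup_le [Module.Finite k M] {ι : Type*} [Fintype ι]
    (Y : ι → Submodule (MonoidAlgebra k G) M) :
    finrank k ((⨆ i, Y i).restrictScalars k) ≤ ∑ i, finrank k ((Y i).restrictScalars k) := by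
  rw [Submodule.restrictScalars_iSup]
  exact Submodule.finrank_iSup_le_sum _

/-- A quotient module of a finite-dimensional module, realized on a space of tuples. -/
theorem exists_tuple_quotient [Module.Finite k M] (N : Submodule (MonoidAlgebra k G) M) :
    ∃ (n : ℕ) (σ : Representation k G (Fin n → k)) (f : M →ₗ[k] (Fin n → k)),
      Function.Surjective f ∧ LinearMap.ker f = N.restrictScalars k ∧
      (∀ g x, f (of k G g • x) = σ g (f x)) ∧
      n + finrank k (N.restrictScalars k) = finrank k M := by
  let ρ : Representation k G M := Representation.ofModule' M
  let N' := N.restrictScalars k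
  have hN : ∀ g, N' ≤ N'.comap (ρ g) := fun g x hx => by
    rw [Submodule.mem_comap, ofModule'_apply_eq]
    exact N.smul_mem _ hx
  -- Coordinates free the quotient from the universe of `G`, so that for k = `ZMod p` it lives in
  -- `Type`.
  let e : (M ⧸ N') ≃ₗ[k] (Fin (finrank k (M ⧸ N')) → k) := (finBasis k (M ⧸ N')).equivFun
  refine ⟨finrank k (M ⧸ N'), (e.conjRingEquiv : End k (M ⧸ N') →* _).comp (ρ.quotient N' hN),
    e.toLinearMap ∘ₗ N'.mkQ, e.surjective.comp N'.mkQ_surjective, ?_, ?_, ?_⟩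
  · rw [LinearEquiv.ker_comp, Submodule.ker_mkQ]
  · intro g x
    rw [← ofModule'_apply_eq]
    simp [Representation.quotient, ρ]
  · exact Submodule.finrank_quotient_add_finrank N'

/-- Functions on `G` fixed by `K` are determined by their values on coset representatives. -/
theorem finrank_fixedVectors_groupAlgebra_mul_card_le [Finite G] (K : Subgroup G) :
    finrank k (fixedVectors (Representation.ofModule' (MonoidAlgebra k G) : Representation k G _) K)
      * Nat.card K ≤ Nat.card G := by
  have := Fintype.ofFinite (G ⧸ K)
  -- Left K-invariance makes coefficients constant on cosets Kg, while `G ⧸ K` consists of cosets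
  -- gK; hence the inverse.
  let ev : MonoidAlgebra k G →ₗ[k] (G ⧸ K → k) :=
    { toFun := fun x q => x.coeff (q.out)⁻¹
      map_add' := fun x y => by ext; simp
      map_smul' := fun c x => by ext; simp }
  have hinj : Function.Injective (ev ∘ₗ (fixedVectors
      (Representation.ofModule' (MonoidAlgebra k G) : Representation k G _) K).subtype) := by
    rw [← LinearMap.ker_eq_bot, LinearMap.ker_eq_bot']
    rintro ⟨x, hx⟩ h0
    ext g
    rw [mem_fixedVectors] at hx
    obtain ⟨l, hl⟩ := QuotientGroup.mk_out_eq_mul K g⁻¹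
    have h1 : x.coeff ((QuotientGroup.mk g⁻¹ : G ⧸ K).out)⁻¹ = 0 := congrFun h0 _
    have h2 := hx l l.2
    rw [ofModule'_apply_eq, smul_eq_mul] at h2
    rw [hl, mul_inv_rev, inv_inv] at h1
    have h3 : (of k G (l : G) * x).coeff g = x.coeff ((l : G)⁻¹ * g) := by
      rw [of_apply, coeff_single_mul_apply, one_mul]
    rw [h2] at h3
    simpa [h1] using h3
  have := LinearMap.finrank_le_finrank_of_injective hinj
  rw [finrank_fintype_fun_eq_card, ← Nat.card_eq_fintype_card] at this
  rw [K.card_eq_card_quotient_mul_card_subgroup]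
  gcongr

omit [Group G] in
theorem finrank_groupAlgebra [Finite G] : finrank k (MonoidAlgebra k G) = Nat.card G := by
  have := Fintype.ofFinite G
  rw [(MonoidAlgebra.coeffLinearEquiv k).finrank_eq, finrank_finsupp_self, Nat.card_eq_fintype_card]

end GroupAlgebraModules

/-! ### The kernel of θ and its invariants -/

section RelationModule

variable {k G ι : Type*} [Field k] [Group G] [Fintype ι]

/-- The map `e i ↦ t i - 1` from a free module to the group algebra has the augmentation ideal as
its image; adding an averaging term makes it surjective without enlarging its kernel. -/
theorem exists_surjective_relation_map [Finite G] [Nonempty ι] (hG : (Nat.card G : k) ≠ 0)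
    {t : ι → G} (ht : Subgroup.closure (Set.range t) = ⊤) :
    ∃ θ : (ι → MonoidAlgebra k G) →ₗ[MonoidAlgebra k G] MonoidAlgebra k G,
      (∃ a₀, θ a₀ = 1) ∧ ∀ a, θ a = 0 → ∑ i, a i * (of k G (t i) - 1) = 0 := by
  classical
  have := Fintype.ofFinite G
  obtain ⟨i₀⟩ := ‹Nonempty ι›
  have hcard : (Fintype.card G : k) ≠ 0 := by rwa [← Nat.card_eq_fintype_card]
  let ε : MonoidAlgebra k G := (Fintype.card G : k)⁻¹ • ∑ g, of k G g
  have hleft (g : G) : of k G g * ε = ε := by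
    simp only [ε, mul_smul_comm, Finset.mul_sum, ← map_mul]
    congr 1
    exact Equiv.sum_comp (Equiv.mulLeft g) fun h => of k G h
  have hright (g : G) : ε * of k G g = ε := by
    simp only [ε, smul_mul_assoc, Finset.sum_mul, ← map_mul]
    congr 1
    exact Equiv.sum_comp (Equiv.mulRight g) fun h => of k G h
  have hone : 1 - ε = -((Fintype.card G : k)⁻¹ • ∑ g, (of k G g - 1)) := by
    rw [Finset.sum_sub_distrib, Finset.sum_const, Finset.card_univ, ← Nat.cast_smul_eq_nsmul k,
      smul_sub, smul_smul, inv_mul_cancel₀ hcard, one_smul, neg_sub]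
  have hidem : ε * ε = ε := by
    have : (1 - ε) * ε = 0 := by
      rw [hone, neg_mul, smul_mul_assoc, Finset.sum_mul]
      simp [sub_mul, hleft, - of_apply]
    rw [sub_mul, one_mul, sub_eq_zero] at this
    exact this.symm
  -- As ε(t - 1) = 0, left multiplication by ε sends `b i₀` to ε, so the image contains ε and then
  -- every t_i - 1.
  let b : ι → MonoidAlgebra k G := fun i => of k G (t i) - 1 + if i = i₀ then ε else 0
  let θ := Fintype.linearCombination (MonoidAlgebra k G) b
  have hθ (a : ι → MonoidAlgebra k G) : θ a = ∑ i, a i * (of k G (t i) - 1) + a i₀ * ε := by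
    simp only [θ, b, Fintype.linearCombination_apply, smul_eq_mul, mul_add, Finset.sum_add_distrib]
    simp
  refine ⟨θ, ?_, ?_⟩
  · let J : Submodule (MonoidAlgebra k G) (MonoidAlgebra k G) := LinearMap.range θ
    have hb (i : ι) : b i ∈ J := ⟨Pi.single i 1, by simp [θ]⟩
    have hε : ε ∈ J := by
      have := J.smul_mem ε (hb i₀)
      simpa [b, mul_add, mul_sub, hright, hidem, - of_apply] using this
    have ht' (i : ι) : of k G (t i) - 1 ∈ J := by
      by_cases hi : i = i₀
      · have := J.sub_mem (hb i) hε
        simpa [b, hi, - of_apply] using this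
      · have := hb i
        simpa [b, hi, - of_apply] using this
    have hg (g : G) : of k G g - 1 ∈ J := by
      have hg : g ∈ Subgroup.closure (Set.range t) := ht ▸ Subgroup.mem_top g
      induction hg using Subgroup.closure_induction with
      | mem x hx => obtain ⟨i, rfl⟩ := hx; exact ht' i
      | one => rw [map_one, sub_self]; exact J.zero_mem
      | mul x y _ _ hx hy =>
        have := J.add_mem (J.smul_mem (of k G x) hy) hx
        simpa only [smul_eq_mul, mul_sub, mul_one, ← map_mul, sub_add_sub_cancel] using this
      | inv x _ hx =>
        have := J.neg_mem (J.smul_mem (of k G x⁻¹) hx)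
        simpa only [smul_eq_mul, mul_sub, mul_one, ← map_mul, inv_mul_cancel, map_one, neg_sub]
          using this
    have h1 : (1 - ε) + ε ∈ J := by
      refine J.add_mem ?_ hε
      rw [hone, ← neg_smul]
      exact (J.restrictScalars k).smul_mem _ (Submodule.sum_mem _ fun g _ => hg g)
    rwa [sub_add_cancel] at h1
  · intro a ha
    -- Right multiplication by ε kills each t_i - 1 and isolates the averaging term.
    have h0 : a i₀ * ε = 0 := by
      have := congrArg (· * ε) ha
      simpa [hθ, add_mul, Finset.sum_mul, mul_assoc, sub_mul, hleft, hidem, - of_apply] using this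
    rwa [hθ, h0, add_zero] at ha

variable {θ : (ι → MonoidAlgebra k G) →ₗ[MonoidAlgebra k G] MonoidAlgebra k G}
  {a₀ : ι → MonoidAlgebra k G}

/-- A submodule containing `a₀` modulo which the basis vectors become a coboundary is
everything. -/
theorem eq_top_of_coboundary [DecidableEq ι] {t : ι → G} (h₀ : θ a₀ = 1)
    (hθ : ∀ a, θ a = 0 → ∑ i, a i * (of k G (t i) - 1) = 0)
    {N : Submodule (MonoidAlgebra k G) (ι → MonoidAlgebra k G)} (ha₀ : a₀ ∈ N)
    (u : ι → MonoidAlgebra k G) (hu : ∀ i, Pi.single i 1 - (of k G (t i) • u - u) ∈ N) :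
    N = ⊤ := by
  have hker (a : ι → MonoidAlgebra k G) (ha : θ a = 0) : a ∈ N := by
    have h1 : ∑ i, a i • (Pi.single i 1 - (of k G (t i) • u - u)) ∈ N :=
      N.sum_mem fun i _ => N.smul_mem _ (hu i)
    have h2 : ∑ i, a i • (of k G (t i) • u - u) = 0 := by
      have (i : ι) : a i • (of k G (t i) • u - u) = (a i * (of k G (t i) - 1)) • u := by
        rw [mul_smul, sub_smul, one_smul]
      simp_rw [this]
      rw [← Finset.sum_smul, hθ a ha, zero_smul]
    simp_rw [smul_sub (a _) (Pi.single _ _)] at h1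
    rw [Finset.sum_sub_distrib, h2, sub_zero] at h1
    convert h1
    ext1 j
    simp [Finset.sum_apply, Pi.single_apply]
  rw [eq_top_iff]
  intro a _
  have h1 := N.add_mem (hker (a - θ a • a₀) (by simp [h₀])) (N.smul_mem (θ a) ha₀)
  rwa [sub_add_cancel] at h1

/-- The vectors of the kernel of `θ` fixed by `K`. -/
noncomputable def fixedKernel (θ : (ι → MonoidAlgebra k G) →ₗ[MonoidAlgebra k G] MonoidAlgebra k G)
    (K : Subgroup G) : Submodule k (ι → MonoidAlgebra k G) :=
  fixedVectors (Representation.ofModule' (ι → MonoidAlgebra k G) : Representation k G _) K ⊓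
    (LinearMap.ker θ).restrictScalars k

omit [Fintype ι] in
theorem mem_fixedKernel {K : Subgroup G} {a : ι → MonoidAlgebra k G} :
    a ∈ fixedKernel θ K ↔ (∀ g ∈ K, of k G g • a = a) ∧ θ a = 0 := by
  rw [fixedKernel, Submodule.mem_inf, mem_fixedVectors]
  simp only [ofModule'_apply_eq, Submodule.restrictScalars_mem, LinearMap.mem_ker]

omit [Fintype ι] in
theorem smul_mem_fixedKernel_of_mem_normalizer {K : Subgroup G} {g : G}
    (hg : g ∈ Subgroup.normalizer (K : Set G)) {a : ι → MonoidAlgebra k G}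
    (ha : a ∈ fixedKernel θ K) : of k G g • a ∈ fixedKernel θ K := by
  rw [mem_fixedKernel] at ha ⊢
  refine ⟨fun h hh => ?_, by rw [map_smul, ha.2, smul_zero]⟩
  have h1 : g⁻¹ * h * g ∈ K := (Subgroup.mem_normalizer_iff''.1 hg h).1 hh
  rw [smul_smul, ← map_mul, show h * g = g * (g⁻¹ * h * g) by group, map_mul, mul_smul, ha.1 _ h1]

-- The splitting a = (a - θ(a) a₀) + θ(a) a₀ respects invariants: if K fixes a, it fixes θ(a). Hence
-- once a₀ is killed, only invariants of ker θ survive.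
omit [Fintype ι] in
theorem fixedVectors_le_fixedKernel_sup (h₀ : θ a₀ = 1) (K : Subgroup G) :
    fixedVectors (Representation.ofModule' (ι → MonoidAlgebra k G) : Representation k G _) K ≤
      fixedKernel θ K ⊔ (Submodule.span (MonoidAlgebra k G) {a₀}).restrictScalars k := by
  intro a ha
  rw [mem_fixedVectors] at ha
  simp only [ofModule'_apply_eq] at ha
  rw [← sub_add_cancel a (θ a • a₀)]
  refine Submodule.add_mem_sup (mem_fixedKernel.2 ⟨fun g hg => ?_, by simp [h₀]⟩)
    (Submodule.smul_mem _ _ (Submodule.mem_span_singleton_self a₀))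
  rw [smul_sub, smul_smul, ← smul_eq_mul, ← map_smul, ha g hg]

/-- (b, r) ↦ b + r a₀ embeds (ker θ)^K ⊕ R^K into (R^K)^d, since θ recovers r; so (ker θ)^K has
dimension at most (d-1) dim R^K. -/
theorem finrank_fixedKernel_mul_card_le [Finite G] (h₀ : θ a₀ = 1) (K : Subgroup G) :
    finrank k (fixedKernel θ K) * Nat.card K ≤ (Fintype.card ι - 1) * Nat.card G := by
  let A := ι → MonoidAlgebra k G
  let R₁ := fixedVectors (Representation.ofModule' (MonoidAlgebra k G) : Representation k G _) K
  have hR₁ {r : MonoidAlgebra k G} : r ∈ R₁ ↔ ∀ g ∈ K, of k G g * r = r := by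
    rw [mem_fixedVectors]
    simp only [ofModule'_apply_eq, smul_eq_mul]
  let Φ : (fixedKernel θ K × R₁) →ₗ[k] (ι → R₁) :=
    LinearMap.pi fun i => LinearMap.codRestrict R₁
      { toFun := fun x => x.1.1 i + x.2.1 * a₀ i
        map_add' := fun x y => by simp [add_mul]; abel
        map_smul' := fun c x => by simp } fun x => hR₁.2 fun g hg => by
          have h1 := congrFun ((mem_fixedKernel.1 x.1.2).1 g hg) i
          rw [Pi.smul_apply, smul_eq_mul] at h1
          have h2 := hR₁.1 x.2.2 g hg
          simp only [LinearMap.coe_mk, AddHom.coe_mk]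
          rw [mul_add, ← mul_assoc, h1, h2]
  have hΦ : Function.Injective Φ := by
    rw [← LinearMap.ker_eq_bot, LinearMap.ker_eq_bot']
    rintro ⟨⟨b, hb⟩, ⟨r, hr⟩⟩ h
    have h1 : b + r • a₀ = 0 := by
      ext1 i
      exact congrArg Subtype.val (congrFun h i)
    have h2 := (mem_fixedKernel.1 hb).2
    have h3 : r = 0 := by
      have := congrArg θ h1
      simpa [h2, h₀] using this
    subst h3
    rw [zero_smul, add_zero] at h1
    subst h1
    rfl
  have h1 := LinearMap.finrank_le_finrank_of_injective hΦ
  rw [finrank_prod, finrank_pi_fintype, Finset.sum_const, Finset.card_univ, smul_eq_mul] at h1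
  have h2 : finrank k R₁ * Nat.card K ≤ Nat.card G :=
    finrank_fixedVectors_groupAlgebra_mul_card_le K
  have h3 : finrank k (fixedKernel θ K) ≤ (Fintype.card ι - 1) * finrank k R₁ := by
    rw [Nat.sub_mul, one_mul]
    exact Nat.le_sub_of_add_le h1
  calc _ ≤ (Fintype.card ι - 1) * finrank k R₁ * Nat.card K := by gcongr
    _ ≤ _ := by rw [mul_assoc]; gcongr

end RelationModule

/-! ### Construction of V and the dimension count -/

/-- The dimension count and all module-theoretic properties, for a nonempty family of
generators. -/
theorem exists_rep_of_nonempty {G : Type*} [Group G] [Finite G] {d : ℕ} (hd : 0 < d)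
    {t : Fin d → G} (ht : Subgroup.closure (Set.range t) = ⊤)
    {p : ℕ} [Fact p.Prime] (hp : ¬ p ∣ Nat.card G)
    {r s : ℕ} (w : Fin r → FreeGroup (Fin d)) (H : Fin s → Subgroup G) :
    ∃ (n : ℕ) (σ : Representation (ZMod p) G (Fin n → ZMod p)) (v : Fin d → Fin n → ZMod p),
      ((d : ℝ) - 1) * Nat.card G ≤ n
        + ∑ i, (Nat.card G : ℝ) / orderOf (FreeGroup.lift t (w i))
        + ∑ j, ((d : ℝ) - 1) * Nat.card G * ((Nat.card G : ℝ) /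
          ((Nat.card (H j) : ℝ) * (Nat.card (Subgroup.normalizer (H j : Set G)) : ℝ))) ∧
      Subgroup.closure (Set.range fun i => repPair σ (v i) (t i)) = ⊤ ∧
      (∀ i, orderOf (FreeGroup.lift (fun k => repPair σ (v k) (t k)) (w i))
          = orderOf (FreeGroup.lift t (w i))) ∧
      (∀ j, fixedVectors σ (H j) = ⊥) ∧
      ∀ K : Subgroup G, (finrank (ZMod p) (fixedVectors σ K) : ℝ) * Nat.card K
        ≤ ((d : ℝ) - 1) * Nat.card G := by
  have : Nonempty (Fin d) := ⟨⟨0, hd⟩⟩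
  have hG : (Nat.card G : ZMod p) ≠ 0 := by rwa [Ne, ZMod.natCast_eq_zero_iff]
  obtain ⟨θ, ⟨a₀, h₀⟩, hθ⟩ := exists_surjective_relation_map hG ht
  let A := Fin d → MonoidAlgebra (ZMod p) G
  let ρ : Representation (ZMod p) G A := Representation.ofModule' A
  have hρ (g : G) (x : A) : ρ g x = of (ZMod p) G g • x := ofModule'_apply_eq g x
  choose a ha hord using fun i => exists_fixed_relator ρ (fun i => Pi.single i 1) t (w i)
  have hfinR : Module.Finite (ZMod p) (MonoidAlgebra (ZMod p) G) :=
    Module.Finite.equiv (MonoidAlgebra.coeffLinearEquiv (ZMod p)).symm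
  let X : Submodule (MonoidAlgebra (ZMod p) G) A := Submodule.span _ {a₀}
  let Y : Fin r → Submodule (MonoidAlgebra (ZMod p) G) A := fun i => Submodule.span _ {a i}
  let Z : Fin s → Submodule (MonoidAlgebra (ZMod p) G) A := fun j =>
    Submodule.span _ (fixedKernel θ (H j))
  let N := X ⊔ (⨆ i, Y i) ⊔ ⨆ j, Z j
  have hXN : X ≤ N := le_sup_left.trans le_sup_left
  obtain ⟨n, σ, f, hs, hker, hf, hdim⟩ := exists_tuple_quotient (k := ZMod p) N
  have hf' (g : G) (x : A) : f (ρ g x) = σ g (f x) := by rw [hρ, hf]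
  have hfN {x : A} (hx : x ∈ N) : f x = 0 := by
    rw [← LinearMap.mem_ker, hker]
    exact hx
  have hfix (K : Subgroup G) : fixedVectors σ K ≤ (fixedKernel θ K).map f := by
    refine (fixedVectors_le_map hG f hf' hs K).trans
      ((Submodule.map_mono (fixedVectors_le_fixedKernel_sup h₀ K)).trans ?_)
    rw [Submodule.map_sup, sup_le_iff]
    refine ⟨le_rfl, ?_⟩
    rintro _ ⟨x, hx, rfl⟩
    rw [hfN (hXN hx)]
    exact Submodule.zero_mem _
  have hkerdim (K : Subgroup G) : (finrank (ZMod p) (fixedKernel θ K) : ℝ) * Nat.card K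
      ≤ ((d : ℝ) - 1) * Nat.card G := by
    have := finrank_fixedKernel_mul_card_le h₀ K
    rw [Fintype.card_fin] at this
    have h1 : ((d - 1 : ℕ) : ℝ) = (d : ℝ) - 1 := by rw [Nat.cast_sub hd, Nat.cast_one]
    rw [← h1]
    exact_mod_cast this
  refine ⟨n, σ, fun i => f (Pi.single i 1), ?_, ?_, fun i => ?_, fun j => ?_, fun K => ?_⟩
  · have hX : finrank (ZMod p) (X.restrictScalars (ZMod p)) ≤ Nat.card G := by
      -- With g = 1 the cyclic bound is just |G|.
      have := finrank_span_singleton_mul_orderOf_le (k := ZMod p) a₀ (1 : G)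
        (by rw [map_one, one_smul])
      rwa [orderOf_one, mul_one] at this
    have hY (i : Fin r) : (finrank (ZMod p) ((Y i).restrictScalars (ZMod p)) : ℝ) ≤
        (Nat.card G : ℝ) / orderOf (FreeGroup.lift t (w i)) := by
      rw [le_div_iff₀ (by exact_mod_cast orderOf_pos _)]
      have := finrank_span_singleton_mul_orderOf_le (k := ZMod p) (a i) _ ((hρ _ _).symm.trans (ha i))
      exact_mod_cast this
    have hZ (j : Fin s) : (finrank (ZMod p) ((Z j).restrictScalars (ZMod p)) : ℝ) ≤
        ((d : ℝ) - 1) * Nat.card G * ((Nat.card G : ℝ) /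
          ((Nat.card (H j) : ℝ) * (Nat.card (Subgroup.normalizer (H j : Set G)) : ℝ))) := by
      have h1 := finrank_span_mul_card_le (fixedKernel θ (H j)) (Subgroup.normalizer (H j : Set G))
        fun g hg x hx => smul_mem_fixedKernel_of_mem_normalizer hg hx
      have h2 : (finrank (ZMod p) ((Z j).restrictScalars (ZMod p)) : ℝ)
          * Nat.card (Subgroup.normalizer (H j : Set G))
          ≤ Nat.card G * finrank (ZMod p) (fixedKernel θ (H j)) := by exact_mod_cast h1
      have hpos : (0 : ℝ) < Nat.card (H j) := by exact_mod_cast Nat.card_pos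
      have hpos' : (0 : ℝ) < Nat.card (Subgroup.normalizer (H j : Set G)) := by
        exact_mod_cast Nat.card_pos
      rw [← mul_div_assoc, le_div_iff₀ (by positivity)]
      calc _ = (finrank (ZMod p) ((Z j).restrictScalars (ZMod p)) : ℝ)
            * Nat.card (Subgroup.normalizer (H j : Set G)) * Nat.card (H j) := by ring
        _ ≤ Nat.card G * finrank (ZMod p) (fixedKernel θ (H j)) * Nat.card (H j) := by gcongr
        _ = (finrank (ZMod p) (fixedKernel θ (H j)) * Nat.card (H j)) * Nat.card G := by ring
        _ ≤ _ := mul_le_mul_of_nonneg_right (hkerdim (H j)) (Nat.cast_nonneg _)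
    have hN : finrank (ZMod p) (N.restrictScalars (ZMod p)) ≤
        finrank (ZMod p) (X.restrictScalars (ZMod p))
          + ∑ i, finrank (ZMod p) ((Y i).restrictScalars (ZMod p))
          + ∑ j, finrank (ZMod p) ((Z j).restrictScalars (ZMod p)) := by
      refine (finrank_restrictScalars_sup_le _ _).trans (add_le_add
        ((finrank_restrictScalars_sup_le _ _).trans (add_le_add le_rfl ?_)) ?_)
      · exact finrank_restrictScalars_iSup_le Y
      · exact finrank_restrictScalars_iSup_le Z
    have hA : finrank (ZMod p) A = d * Nat.card G := by
      rw [finrank_pi_fintype, Finset.sum_const, Finset.card_univ, Fintype.card_fin,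
        finrank_groupAlgebra, smul_eq_mul]
    have h1 : (d * Nat.card G : ℝ) ≤ n + (Nat.card G
          + ∑ i, (finrank (ZMod p) ((Y i).restrictScalars (ZMod p)) : ℝ)
          + ∑ j, (finrank (ZMod p) ((Z j).restrictScalars (ZMod p)) : ℝ)) := by
      have : finrank (ZMod p) A ≤ n + (Nat.card G
          + ∑ i, finrank (ZMod p) ((Y i).restrictScalars (ZMod p))
          + ∑ j, finrank (ZMod p) ((Z j).restrictScalars (ZMod p))) := by
        rw [← hdim]
        omega
      rw [hA] at this
      exact_mod_cast this
    have h2 := Finset.sum_le_sum fun i (_ : i ∈ Finset.univ) => hY i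
    have h3 := Finset.sum_le_sum fun j (_ : j ∈ Finset.univ) => hZ j
    linarith
  · refine closure_repPair_eq_top hp σ ht _ fun N' hN' u hu => ?_
    obtain ⟨u', rfl⟩ := hs u
    -- The criterion is checked upstairs, on the preimage of N' in the free module.
    let N'' : Submodule (MonoidAlgebra (ZMod p) G) A :=
      { N'.comap f with
        smul_mem' := fun c x hx => smul_mem_of_forall_of_smul_mem (D := N'.comap f)
          (fun g y hy => by
            rw [Submodule.mem_comap, hf]
            exact hN' g _ hy) c hx }
    have hmem {x : A} : x ∈ N'' ↔ f x ∈ N' := Iff.rfl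
    have htop : N'' = ⊤ := by
      refine eq_top_of_coboundary h₀ hθ ?_ u' fun i => ?_
      · rw [hmem, hfN (hXN (Submodule.mem_span_singleton_self a₀))]
        exact N'.zero_mem
      · rw [hmem, map_sub, map_sub, hf]
        exact hu i
    rw [eq_top_iff]
    intro y _
    obtain ⟨x, rfl⟩ := hs y
    exact hmem.1 (htop ▸ Submodule.mem_top)
  · refine hord i σ f hf' (hfN ?_)
    exact (le_sup_right.trans le_sup_left : (⨆ i, Y i) ≤ N)
      (Submodule.mem_iSup_of_mem i (Submodule.mem_span_singleton_self (a i)))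
  · rw [eq_bot_iff]
    refine (hfix (H j)).trans ?_
    rintro _ ⟨x, hx, rfl⟩
    rw [hfN ((le_sup_right : (⨆ j, Z j) ≤ N) (Submodule.mem_iSup_of_mem j
      (Submodule.subset_span hx)))]
    exact Submodule.zero_mem _
  · refine le_trans ?_ (hkerdim K)
    gcongr
    exact (Submodule.finrank_mono (hfix K)).trans (Submodule.finrank_map_le _ _)

/-! ### The theorem, including d = 0 -/

theorem theorem4p4 {G : Type*} [Group G] [Finite G]
    {d : ℕ} (t : Fin d → G) (ht : Subgroup.closure (Set.range t) = ⊤)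
    {p : ℕ} [Fact p.Prime] (hp : ¬ p ∣ Nat.card G)
    {r s : ℕ} (w : Fin r → FreeGroup (Fin d)) (H : Fin s → Subgroup G)
    -- the terms indexed by `Fin r` in `δ` make sense
    (hd : d = 1 → r = 0)
    (δ : ℝ)
    (hδ : δ = 1
      - ∑ i : Fin r, 1 / ((orderOf (FreeGroup.lift t (w i)) : ℝ) * ((d : ℝ) - 1))
      - ∑ j : Fin s, (Nat.card G : ℝ) /
          ((Nat.card (H j) : ℝ) * (Nat.card (Subgroup.normalizer (H j : Set G)) : ℝ)))
    (hδ_pos : 0 < δ) :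
    ∃ (V : Type) (_ : AddCommGroup V) (_ : Module (ZMod p) V)
      (ρ : Representation (ZMod p) G V) (v : Fin d → V),
      Module.Finite (ZMod p) V ∧
      ((d : ℝ) - 1) * (Nat.card G : ℝ) * δ ≤ (Module.finrank (ZMod p) V : ℝ) ∧
      Subgroup.closure (Set.range fun i : Fin d => repPair ρ (v i) (t i)) = ⊤ ∧
      (∀ i : Fin r,
        orderOf (FreeGroup.lift (fun k : Fin d => repPair ρ (v k) (t k)) (w i))
          = orderOf (FreeGroup.lift t (w i))) ∧
      (∀ j : Fin s, fixedVectors ρ (H j) = ⊥) ∧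
      (∀ K : Subgroup G,
        (Module.finrank (ZMod p) (fixedVectors ρ K) : ℝ)
          ≤ 1 / (δ * (Nat.card K : ℝ)) * (Module.finrank (ZMod p) V : ℝ)) := by
  rcases Nat.eq_zero_or_pos d with rfl | hd0
  · have hsub : Subsingleton G := by
      rw [← Subgroup.subsingleton_iff, ← subsingleton_iff_bot_eq_top, ← ht]
      simp
    refine ⟨Fin 0 → ZMod p, inferInstance, inferInstance, 1, 0, inferInstance, ?_, ?_,
      fun i => ?_, fun j => Subsingleton.elim _ _, fun K => ?_⟩
    -- For d = 0 the required lower bound is -|G|δ < 0, so V = 0 suffices.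
    · have : (0 : ℝ) < Nat.card G := by exact_mod_cast Nat.card_pos
      simp only [Nat.cast_zero, finrank_fintype_fun_eq_card, Fintype.card_fin]
      nlinarith [mul_pos this hδ_pos]
    · rw [eq_top_iff]
      rintro x -
      have : x = 1 := SemidirectProduct.ext (Subsingleton.elim _ _) (Subsingleton.elim _ _)
      rw [this]
      exact Subgroup.one_mem _
    · rw [Subsingleton.elim (w i) 1, map_one, map_one, orderOf_one, orderOf_one]
    · rw [Module.finrank_zero_of_subsingleton, Module.finrank_zero_of_subsingleton]
      simp
  · obtain ⟨n, σ, v, hdim, hgen, hord, hH, hK⟩ := exists_rep_of_nonempty hd0 ht hp w H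
    have hn : ((d : ℝ) - 1) * Nat.card G * δ ≤ n := by
      have hterm (i : Fin r) : ((d : ℝ) - 1) * Nat.card G *
          (1 / ((orderOf (FreeGroup.lift t (w i)) : ℝ) * ((d : ℝ) - 1)))
          = (Nat.card G : ℝ) / orderOf (FreeGroup.lift t (w i)) := by
        -- An index i exists here, so r ≠ 0, which excludes d = 1.
        have hd1 : (d : ℝ) - 1 ≠ 0 := by
          intro h
          have h1 : d = 1 := by
            have : (d : ℝ) = 1 := by linarith
            exact_mod_cast this
          have := hd h1
          subst this
          exact i.elim0
        have : (orderOf (FreeGroup.lift t (w i)) : ℝ) ≠ 0 := by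
          exact_mod_cast (orderOf_pos _).ne'
        field_simp
      rw [hδ, mul_sub, mul_sub, mul_one, Finset.mul_sum, Finset.mul_sum,
        Finset.sum_congr rfl fun i _ => hterm i]
      linarith
    refine ⟨Fin n → ZMod p, inferInstance, inferInstance, σ, v, inferInstance, ?_, hgen, hord, hH,
      fun K => ?_⟩
    · rwa [finrank_fintype_fun_eq_card, Fintype.card_fin]
    · have hKpos : (0 : ℝ) < Nat.card K := by exact_mod_cast Nat.card_pos
      rw [finrank_fintype_fun_eq_card, Fintype.card_fin, one_div_mul_eq_div,
        le_div_iff₀ (by positivity)]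
      calc _ = (finrank (ZMod p) (fixedVectors σ K) : ℝ) * Nat.card K * δ := by ring
        _ ≤ ((d : ℝ) - 1) * Nat.card G * δ := mul_le_mul_of_nonneg_right (hK K) hδ_pos.le
        _ ≤ n := hn
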